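/- Let $n\ge 1$. For $s\in\mathbb C$ with $\operatorname{Re}(s)>-n$ let $h_s$ be the tempered distribution on $\mathbb R^n$ given by the locally integrable function $h_s(\xi)=\Gamma\big(\tfrac n2+\tfrac s2\big)^{-1}|\xi|^s$. The map $s\mapsto h_s$ extends to an entire function on $\mathbb C$ with values in the space $\mathcal S'(\mathbb R^n)$ of tempered distributions (that is, $s\mapsto\langle h_s,\varphi\rangle$ is entire for every $\varphi\in\mathcal S(\mathbb R^n)$); write $h_s$, $s\in\mathbb C$, for this extension. For $\lambda\in\mathbb C$ define $$J_\lambda:\mathcal S(\mathbb R^n)\to\mathcal S'(\mathbb R^n),\quad J_\lambda f=h_{-2n+2\lambda}\star f,\qquad E_\lambda=(2\lambda-n+2)\frac{\partial}{\partial\xi_n}+\xi_n\Delta,\quad \Delta=\sum_{j=1}^n\frac{\partial^2}{\partial\xi_j^2},$$ and let $M$ be the operator of multiplication by the last coordinate $\xi_n$ on $\mathcal S'(\mathbb R^n)$. Then, for every $\lambda\in\mathbb C$ with $\lambda\ne n-1$, $$M\circ J_\lambda=\frac{1}{4(\lambda-n+1)}\,J_{\lambda+1}\circ E_\lambda$$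 as operators from $\mathcal S(\mathbb R^n)$ to $\mathcal S'(\mathbb R^n)$. For $\lambda=n-1$ one has $J_n\circ E_{n-1}=0$, and the identity holds as a residue formula: for every $f\in\mathcal S(\mathbb R^n)$, $$M(J_{n-1}f)=\lim_{\lambda\to n-1,\ \lambda\neq n-1}\frac{1}{4(\lambda-n+1)}\,J_{\lambda+1}(E_\lambda f)\quad\text{in }\mathcal S'(\mathbb R^n)\text{ (pointwise on test functions)}.$$ -/

import Mathlib

open MeasureTheory Filter Topology
open scoped SchwartzMap

noncomputable section

namespace KnappStein

/-- `ℝⁿ` with its Euclidean norm and Lebesgue measure. -/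
abbrev Eucl (n : ℕ) : Type := EuclideanSpace ℝ (Fin n)

/-- The index of the last coordinate of `ℝⁿ`, for `n ≥ 1`. -/
def lastIdx (n : ℕ) [NeZero n] : Fin n := ⟨n - 1, Nat.sub_one_lt (NeZero.ne n)⟩

/-- The last coordinate function `ξ ↦ ξ_n`, complex valued. -/
def lastCoord (n : ℕ) [NeZero n] : Eucl n → ℂ := fun ξ => ((ξ (lastIdx n) : ℝ) : ℂ)

/-- The coordinate function has temperate growth, so multiplying by it with `smulLeftCLM` is the
honest multiplication. -/
theorem lastCoord_hasTemperateGrowth (n : ℕ) [NeZero n] :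
    (lastCoord n).HasTemperateGrowth :=
  (Complex.ofRealCLM.comp
    (EuclideanSpace.proj (lastIdx n) : Eucl n →L[ℝ] ℝ)).hasTemperateGrowth

/-- The function `|ξ|^s / Γ(n/2 + s/2)`. -/
def normPow (n : ℕ) (s : ℂ) (ξ : Eucl n) : ℂ :=
  (Complex.Gamma ((n : ℂ) / 2 + s / 2))⁻¹ * ((‖ξ‖ : ℝ) : ℂ) ^ s

/-- `H : ℂ → 𝓢'(ℝⁿ)` is the analytic continuation of the distribution-valued function that sends
`s` with `Re s > -n` to the locally integrable function `|ξ|^s / Γ(n/2 + s/2)`: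
it is entire (tested against every Schwartz function), and it is given by that function on the
half plane `Re s > -n`. -/
structure IsEntireExtension (n : ℕ) (H : ℂ → 𝓢'(Eucl n, ℂ)) : Prop where
  entire : ∀ φ : 𝓢(Eucl n, ℂ), Differentiable ℂ (fun s => H s φ)
  eq_integral : ∀ s : ℂ, -(n : ℝ) < s.re → ∀ φ : 𝓢(Eucl n, ℂ),
    H s φ = ∫ ξ : Eucl n, normPow n s ξ * φ ξ

/-- By the identity theorem there is at most one such continuation. -/
theorem IsEntireExtension.unique {n : ℕ} {H K : ℂ → 𝓢'(Eucl n, ℂ)}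
    (hH : IsEntireExtension n H) (hK : IsEntireExtension n K) : H = K := by
  funext s
  ext φ
  have h1 : AnalyticOnNhd ℂ (fun s => H s φ) Set.univ :=
    (hH.entire φ).differentiableOn.analyticOnNhd isOpen_univ
  have h2 : AnalyticOnNhd ℂ (fun s => K s φ) Set.univ :=
    (hK.entire φ).differentiableOn.analyticOnNhd isOpen_univ
  have hev : (fun s => H s φ) =ᶠ[𝓝 (0 + 1 : ℂ)] (fun s => K s φ) := by
    have ho : IsOpen {z : ℂ | -(n : ℝ) < z.re} := isOpen_lt continuous_const Complex.continuous_re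
    have hm : (0 + 1 : ℂ) ∈ {z : ℂ | -(n : ℝ) < z.re} := by
      have : (0 : ℝ) ≤ n := Nat.cast_nonneg n
      simp only [Set.mem_ofPred_eq, zero_add, Complex.one_re]
      linarith
    filter_upwards [ho.mem_nhds hm] with z hz
    rw [hH.eq_integral z hz, hK.eq_integral z hz]
  exact congrFun (h1.eq_of_eventuallyEq h2 hev) s

open Classical in
/-- The tempered distribution `h_s`, `s ∈ ℂ`: the value at `s` of the entire extension of
`s ↦ |ξ|^s / Γ(n/2 + s/2)`. (The value `0` in the absence of an extension is there only
to make this a total definition: the extension exists.) -/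
def h (n : ℕ) (s : ℂ) : 𝓢'(Eucl n, ℂ) :=
  if H : ∃ K : ℂ → 𝓢'(Eucl n, ℂ), IsEntireExtension n K then H.choose s else 0

/-- The reflection `f ↦ f(-·)` on Schwartz functions. -/
def reflect (n : ℕ) : 𝓢(Eucl n, ℂ) →L[ℂ] 𝓢(Eucl n, ℂ) :=
  SchwartzMap.compCLMOfContinuousLinearEquiv ℂ (ContinuousLinearEquiv.neg ℝ (M := Eucl n))

/-- The convolution `f ↦ T ⋆ f` of a tempered distribution `T` with Schwartz functions `f`, as an
operator from `𝓢(ℝⁿ)` to `𝓢'(ℝⁿ)`: `⟨T ⋆ f, φ⟩ = ⟨T, f(-·) ⋆ φ⟩`. -/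
def conv {n : ℕ} (T : 𝓢'(Eucl n, ℂ)) : 𝓢(Eucl n, ℂ) →L[ℂ] 𝓢'(Eucl n, ℂ) where
  toFun f := PointwiseConvergenceCLM.precomp ℂ
    (SchwartzMap.convolution (ContinuousLinearMap.mul ℂ ℂ) (reflect n f)) T
  map_add' f g := by
    ext φ
    change T (SchwartzMap.convolution (ContinuousLinearMap.mul ℂ ℂ) (reflect n (f + g)) φ) =
      T (SchwartzMap.convolution (ContinuousLinearMap.mul ℂ ℂ) (reflect n f) φ) +
        T (SchwartzMap.convolution (ContinuousLinearMap.mul ℂ ℂ) (reflect n g) φ)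
    rw [map_add, map_add, ← map_add T]
    rfl
  map_smul' c f := by
    ext φ
    change T (SchwartzMap.convolution (ContinuousLinearMap.mul ℂ ℂ) (reflect n (c • f)) φ) =
      c • T (SchwartzMap.convolution (ContinuousLinearMap.mul ℂ ℂ) (reflect n f) φ)
    rw [map_smul, map_smul, ← map_smul T]
    rfl
  cont := PointwiseConvergenceCLM.continuous_of_continuous_eval fun φ =>
    T.continuous.comp ((SchwartzMap.convolution_continuous_left (ContinuousLinearMap.mul ℂ ℂ)
      φ).comp (reflect n).continuous)

/-- The Knapp–Stein operator `J_λ f = h_{-2n+2λ} ⋆ f`. -/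
def J (n : ℕ) (lam : ℂ) : 𝓢(Eucl n, ℂ) →L[ℂ] 𝓢'(Eucl n, ℂ) :=
  conv (h n (-2 * n + 2 * lam))

/-- Multiplication by `ξ_n` on tempered distributions. -/
def M (n : ℕ) [NeZero n] : 𝓢'(Eucl n, ℂ) →L[ℂ] 𝓢'(Eucl n, ℂ) :=
  TemperedDistribution.smulLeftCLM ℂ (lastCoord n)

/-- The differential operator `E_λ = (2λ - n + 2) ∂/∂ξ_n + ξ_n Δ` on Schwartz functions. -/
def E (n : ℕ) [NeZero n] (lam : ℂ) : 𝓢(Eucl n, ℂ) →L[ℂ] 𝓢(Eucl n, ℂ) :=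
  (2 * lam - n + 2) •
      LineDeriv.lineDerivOpCLM ℂ 𝓢(Eucl n, ℂ) (EuclideanSpace.single (lastIdx n) (1 : ℝ)) +
    SchwartzMap.smulLeftCLM ℂ (lastCoord n) ∘L LineDeriv.laplacianCLM ℂ (Eucl n) 𝓢(Eucl n, ℂ)

end KnappStein

end

noncomputable section

namespace KnappStein

open scoped LineDeriv Laplacian FourierTransform

/-! Everything rests on two identities for the family: `Δ h_{s+2} = 2(s+2) h_s` (`h_laplacian`) and
`2(s+2) ξ_i h_s = (n+s) ∂_i h_{s+2}` (`h_coordMul`). Far to the right they are integration by parts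
plus the functional equation of `Γ`; since both sides are entire in `s`, they hold everywhere.

Put `s = -2n + 2λ`, so that `2(s+2) = 4(λ-n+1)` and `n+s = 2λ-n`. Since `ξ_n (h_s ⋆ f) = (ξ_n h_s) ⋆
f + h_s ⋆ (ξ_n f)`, multiplying by `2(s+2)` gives `h_{s+2} ⋆ ((2λ-n) ∂_n f + Δ(ξ_n f))`, and `Δ(ξ_n
f) = ξ_n Δf + 2 ∂_n f` turns the bracket into `E_λ f`. This division-free identity (`J_E_apply`)
yields all claims about `J`: divide by `4(λ-n+1)`, set `λ = n-1`, or use continuity in `λ`.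

The entire extension is built by widening the half plane two units at a time through `h_s = Δ
h_{s+2} / (2(s+2))`. The only possible pole, `s = -2`, is removable because `h_0` is constant and so
is killed by `Δ`. -/

/-! ### Functions of tempered growth as distributions. -/

/-- Measurable functions that are integrable against a negative power of `1 + ‖x‖`; these
define tempered distributions. -/
def IsTemperedFun {n : ℕ} (g : Eucl n → ℂ) : Prop :=
  AEStronglyMeasurable g volume ∧
    ∃ m : ℕ, Integrable (fun x : Eucl n => ‖g x‖ * ((1 + ‖x‖) ^ m)⁻¹)

theorem schwartz_bound {n : ℕ} (m : ℕ) (φ : 𝓢(Eucl n, ℂ)) (x : Eucl n) :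
    ‖φ x‖ ≤ (2 ^ m * ((Finset.Iic (m, 0)).sup
      (schwartzSeminormFamily ℂ (Eucl n) ℂ)) φ) * ((1 + ‖x‖) ^ m)⁻¹ := by
  have h := SchwartzMap.one_add_le_sup_seminorm_apply (𝕜 := ℂ) (m := (m, 0)) (k := m) (n := 0)
    le_rfl le_rfl φ x
  rw [norm_iteratedFDeriv_zero] at h
  have hp : (0 : ℝ) < (1 + ‖x‖) ^ m := by positivity
  rw [← div_eq_mul_inv, le_div_iff₀ hp, mul_comm]
  exact h

theorem norm_mul_schwartz_le {n : ℕ} (g : Eucl n → ℂ) (m : ℕ) (φ : 𝓢(Eucl n, ℂ)) (x : Eucl n) :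
    ‖g x * φ x‖ ≤ (2 ^ m * ((Finset.Iic (m, 0)).sup
      (schwartzSeminormFamily ℂ (Eucl n) ℂ)) φ) * (‖g x‖ * ((1 + ‖x‖) ^ m)⁻¹) := by
  rw [norm_mul, mul_left_comm]
  exact mul_le_mul_of_nonneg_left (schwartz_bound m φ x) (norm_nonneg _)

theorem IsTemperedFun.integrable_mul {n : ℕ} {g : Eucl n → ℂ} (hg : IsTemperedFun g)
    (φ : 𝓢(Eucl n, ℂ)) : Integrable (fun x => g x * φ x) := by
  obtain ⟨hm, m, hi⟩ := hg
  refine (hi.const_mul (2 ^ m * ((Finset.Iic (m, 0)).sup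
    (schwartzSeminormFamily ℂ (Eucl n) ℂ)) φ)).mono'
    (hm.mul φ.continuous.aestronglyMeasurable) (ae_of_all _ fun x => ?_)
  exact norm_mul_schwartz_le g m φ x

/-- The tempered distribution `φ ↦ ∫ g φ`. -/
def IsTemperedFun.toDistr {n : ℕ} {g : Eucl n → ℂ} (hg : IsTemperedFun g) : 𝓢'(Eucl n, ℂ) :=
  ContinuousLinearMap.toPointwiseConvergenceCLM _ _ _ _ <|
  SchwartzMap.mkCLMtoNormedSpace (σ := RingHom.id ℂ) (fun φ : 𝓢(Eucl n, ℂ) => ∫ x, g x * φ x)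
    (fun φ ψ => by
      simp only [_root_.add_apply, mul_add]
      exact integral_add (hg.integrable_mul φ) (hg.integrable_mul ψ))
    (fun c φ => by
      simp only [_root_.smul_apply, smul_eq_mul, RingHom.id_apply]
      rw [← integral_const_mul]
      congr 1; ext x; ring)
    (by
      obtain ⟨hm, m, hi⟩ := id hg
      refine ⟨Finset.Iic (m, 0), (∫ x : Eucl n, ‖g x‖ * ((1 + ‖x‖) ^ m)⁻¹) * 2 ^ m,
        mul_nonneg (integral_nonneg fun x => by positivity) (by positivity), fun φ => ?_⟩
      refine (norm_integral_le_of_norm_le (hi.const_mul (2 ^ m * ((Finset.Iic (m, 0)).sup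
        (schwartzSeminormFamily ℂ (Eucl n) ℂ)) φ)) (ae_of_all _ fun x => ?_)).trans (le_of_eq ?_)
      · exact norm_mul_schwartz_le g m φ x
      · rw [integral_const_mul]; ring)

theorem IsTemperedFun.mono {n : ℕ} {g g' : Eucl n → ℂ} (hg : IsTemperedFun g)
    (hm : AEStronglyMeasurable g' volume) (hle : ∀ᵐ x, ‖g' x‖ ≤ ‖g x‖) : IsTemperedFun g' := by
  obtain ⟨_, m, hi⟩ := hg
  refine ⟨hm, m, hi.mono' (hm.norm.mul ?_) ?_⟩
  · exact Continuous.aestronglyMeasurable <| by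
      refine Continuous.inv₀ (by fun_prop) fun x => by positivity
  · filter_upwards [hle] with x hx
    rw [norm_mul, norm_norm, Real.norm_of_nonneg (by positivity : 0 ≤ ((1 + ‖x‖) ^ m)⁻¹)]
    gcongr

theorem IsTemperedFun.add {n : ℕ} {g g' : Eucl n → ℂ} (hg : IsTemperedFun g)
    (hg' : IsTemperedFun g') : IsTemperedFun (fun x => g x + g' x) := by
  obtain ⟨h1, m, hi⟩ := hg
  obtain ⟨h1', m', hi'⟩ := hg'
  refine ⟨h1.add h1', max m m', (hi.add hi').mono' ((h1.add h1').norm.mul ?_) ?_⟩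
  · exact Continuous.aestronglyMeasurable <| by
      refine Continuous.inv₀ (by fun_prop) fun x => by positivity
  · refine ae_of_all _ fun x => ?_
    rw [norm_mul, norm_norm,
      Real.norm_of_nonneg (by positivity : 0 ≤ ((1 + ‖x‖) ^ (max m m'))⁻¹)]
    have h1 : (1 : ℝ) ≤ 1 + ‖x‖ := by linarith [norm_nonneg x]
    have a1 : ((1 + ‖x‖) ^ (max m m'))⁻¹ ≤ ((1 + ‖x‖) ^ m)⁻¹ :=
      inv_anti₀ (by positivity) (pow_le_pow_right₀ h1 (le_max_left _ _))
    have a2 : ((1 + ‖x‖) ^ (max m m'))⁻¹ ≤ ((1 + ‖x‖) ^ m')⁻¹ :=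
      inv_anti₀ (by positivity) (pow_le_pow_right₀ h1 (le_max_right _ _))
    calc ‖g x + g' x‖ * ((1 + ‖x‖) ^ (max m m'))⁻¹
        ≤ (‖g x‖ + ‖g' x‖) * ((1 + ‖x‖) ^ (max m m'))⁻¹ := by gcongr; exact norm_add_le _ _
      _ = ‖g x‖ * ((1 + ‖x‖) ^ (max m m'))⁻¹ + ‖g' x‖ * ((1 + ‖x‖) ^ (max m m'))⁻¹ := by ring
      _ ≤ ‖g x‖ * ((1 + ‖x‖) ^ m)⁻¹ + ‖g' x‖ * ((1 + ‖x‖) ^ m')⁻¹ := by gcongr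

theorem IsTemperedFun.const_mul {n : ℕ} {g : Eucl n → ℂ} (hg : IsTemperedFun g) (c : ℂ) :
    IsTemperedFun (fun x => c * g x) := by
  obtain ⟨h1, m, hi⟩ := hg
  refine ⟨h1.const_mul c, m, (hi.const_mul ‖c‖).congr (ae_of_all _ fun x => ?_)⟩
  simp only [norm_mul]; ring

/-! ### Integrability of powers of the norm, with and without a logarithm. -/

theorem ae_norm_pos (n : ℕ) [NeZero n] : ∀ᵐ x : Eucl n, 0 < ‖x‖ := by
  have h : ∀ᵐ x : Eucl n, x ≠ 0 := by
    rw [ae_iff]; simp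
  filter_upwards [h] with x hx
  exact norm_pos_iff.2 hx

/-- In polar coordinates the integrand is `r^(n-1+a) (1+r)^(-m)`: `a > -n` handles `r ≤ 1`, and `m >
n + a` handles `r > 1`. -/
theorem integrable_norm_rpow_mul_inv (n : ℕ) [NeZero n] {a : ℝ} {m : ℕ} (ha : -(n : ℝ) < a)
    (hm : (n : ℝ) + a < m) :
    Integrable (fun x : Eucl n => ‖x‖ ^ a * ((1 + ‖x‖) ^ m)⁻¹) := by
  have hn : (1 : ℝ) ≤ n := by exact_mod_cast NeZero.one_le
  rw [integrable_fun_norm_addHaar volume (f := fun r : ℝ => r ^ a * ((1 + r) ^ m)⁻¹),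
    finrank_euclideanSpace_fin]
  have hmeas : Measurable (fun y : ℝ => y ^ (n - 1) • (y ^ a * ((1 + y) ^ m)⁻¹)) := by fun_prop
  have key : ∀ y : ℝ, 0 < y → y ^ (n - 1) • (y ^ a * ((1 + y) ^ m)⁻¹) =
      y ^ ((n : ℝ) - 1 + a) * ((1 + y) ^ m)⁻¹ := fun y hy => by
    rw [Real.rpow_add hy, smul_eq_mul, ← mul_assoc]
    congr 2
    rw [← Real.rpow_natCast, Nat.cast_sub NeZero.one_le, Nat.cast_one]
  rw [← Set.Ioc_union_Ioi_eq_Ioi zero_le_one]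
  refine IntegrableOn.union ?_ ?_
  · have h1 : IntegrableOn (fun y : ℝ => y ^ ((n : ℝ) - 1 + a)) (Set.Ioc 0 1) := by
      rw [← intervalIntegrable_iff_integrableOn_Ioc_of_le zero_le_one]
      exact intervalIntegral.intervalIntegrable_rpow' (by linarith)
    refine Integrable.mono' h1 hmeas.aestronglyMeasurable ?_
    filter_upwards [ae_restrict_mem measurableSet_Ioc] with y hy
    have hy0 := hy.1
    rw [key y hy0, Real.norm_of_nonneg (by positivity)]
    refine mul_le_of_le_one_right (by positivity) (inv_le_one_of_one_le₀ ?_)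
    exact one_le_pow₀ (by linarith)
  · have h1 : IntegrableOn (fun y : ℝ => y ^ ((n : ℝ) - 1 + a - m)) (Set.Ioi 1) :=
      integrableOn_Ioi_rpow_of_lt (by linarith) one_pos
    refine Integrable.mono' h1 hmeas.aestronglyMeasurable ?_
    filter_upwards [ae_restrict_mem measurableSet_Ioi] with y hy
    have hy0 : 0 < y := one_pos.trans hy
    rw [key y hy0, Real.norm_of_nonneg (by positivity), Real.rpow_sub hy0, Real.rpow_natCast,
      div_eq_mul_inv]
    gcongr
    linarith

theorem measurable_norm_cpow {n : ℕ} (s : ℂ) :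
    Measurable (fun x : Eucl n => ((‖x‖ : ℝ) : ℂ) ^ s) := by
  fun_prop

theorem norm_norm_cpow {n : ℕ} {x : Eucl n} (hx : 0 < ‖x‖) (s : ℂ) :
    ‖((‖x‖ : ℝ) : ℂ) ^ s‖ = ‖x‖ ^ s.re :=
  Complex.norm_cpow_eq_rpow_re_of_pos hx s

theorem isTemperedFun_cpow (n : ℕ) [NeZero n] {s : ℂ} (hs : -(n : ℝ) < s.re) :
    IsTemperedFun (fun x : Eucl n => ((‖x‖ : ℝ) : ℂ) ^ s) := by
  obtain ⟨m, hm⟩ := exists_nat_gt ((n : ℝ) + s.re)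
  refine ⟨(measurable_norm_cpow s).aestronglyMeasurable, m,
    (integrable_norm_rpow_mul_inv n hs hm).congr ?_⟩
  filter_upwards [ae_norm_pos n] with x hx
  rw [norm_norm_cpow hx]

theorem rpow_le_rpow_add_rpow {r a b c : ℝ} (hr : 0 < r) (hab : a ≤ b) (hbc : b ≤ c) :
    r ^ b ≤ r ^ a + r ^ c := by
  have h1 := Real.rpow_pos_of_pos hr a
  have h2 := Real.rpow_pos_of_pos hr c
  rcases le_total r 1 with h | h
  · linarith [Real.rpow_le_rpow_of_exponent_ge hr h hab]
  · linarith [Real.rpow_le_rpow_of_exponent_le h hbc]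

theorem abs_log_le_rpow {r ε : ℝ} (hr : 0 < r) (hε : 0 < ε) :
    |Real.log r| ≤ (r ^ (-ε) + r ^ ε) / ε := by
  have h1 := Real.log_le_rpow_div hr.le hε
  have h2 := Real.log_le_rpow_div (inv_nonneg.2 hr.le) hε
  rw [Real.log_inv, Real.inv_rpow hr.le, ← Real.rpow_neg hr.le] at h2
  have p1 : 0 < r ^ (-ε) / ε := by positivity
  have p2 : 0 < r ^ ε / ε := by positivity
  rw [add_div, abs_le]
  constructor <;> linarith

/-- Near `s₀` the derivative `log r * r ^ s` is dominated by two powers of `r`. -/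
theorem abs_log_mul_rpow_le {r ε a b : ℝ} (hr : 0 < r) (hε : 0 < ε) (hab : |b - a| ≤ ε) :
    |Real.log r| * r ^ b ≤ 2 / ε * (r ^ (a - 2 * ε) + r ^ (a + 2 * ε)) := by
  obtain ⟨h1, h2⟩ := abs_le.1 hab
  have e1 : r ^ (b - ε) ≤ r ^ (a - 2 * ε) + r ^ (a + 2 * ε) :=
    rpow_le_rpow_add_rpow hr (by linarith) (by linarith)
  have e2 : r ^ (b + ε) ≤ r ^ (a - 2 * ε) + r ^ (a + 2 * ε) :=
    rpow_le_rpow_add_rpow hr (by linarith) (by linarith)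
  calc |Real.log r| * r ^ b ≤ (r ^ (-ε) + r ^ ε) / ε * r ^ b := by
        gcongr; exact abs_log_le_rpow hr hε
    _ = (r ^ (b - ε) + r ^ (b + ε)) / ε := by
        rw [sub_eq_add_neg b ε, Real.rpow_add hr, Real.rpow_add hr]; ring
    _ ≤ ((r ^ (a - 2 * ε) + r ^ (a + 2 * ε)) + (r ^ (a - 2 * ε) + r ^ (a + 2 * ε))) / ε := by
        gcongr
    _ = _ := by ring

theorem measurable_log_mul_norm_cpow {n : ℕ} (s : ℂ) :
    Measurable (fun x : Eucl n => ((Real.log ‖x‖ : ℝ) : ℂ) * ((‖x‖ : ℝ) : ℂ) ^ s) :=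
  (by fun_prop : Measurable (fun x : Eucl n => ((Real.log ‖x‖ : ℝ) : ℂ))).mul
    (measurable_norm_cpow s)

theorem isTemperedFun_log_mul_cpow (n : ℕ) [NeZero n] {s : ℂ} (hs : -(n : ℝ) < s.re) :
    IsTemperedFun
      (fun x : Eucl n => ((Real.log ‖x‖ : ℝ) : ℂ) * ((‖x‖ : ℝ) : ℂ) ^ s) := by
  -- A third of the distance to the boundary, so that the exponent `s.re - 2ε` still exceeds `-n`.
  set ε : ℝ := (s.re + n) / 3 with hε
  have hε0 : 0 < ε := by rw [hε]; linarith
  have h1 := ((isTemperedFun_cpow n (s := ((s.re - 2 * ε : ℝ) : ℂ))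
    (by rw [Complex.ofReal_re, hε]; linarith)).add
    (isTemperedFun_cpow n (s := ((s.re + 2 * ε : ℝ) : ℂ))
    (by rw [Complex.ofReal_re, hε]; linarith))).const_mul ((2 / ε : ℝ) : ℂ)
  refine h1.mono (measurable_log_mul_norm_cpow s).aestronglyMeasurable ?_
  filter_upwards [ae_norm_pos n] with x hx
  rw [norm_mul, norm_norm_cpow hx, Complex.norm_real, Real.norm_eq_abs]
  refine (abs_log_mul_rpow_le (a := s.re) hx hε0 (by simpa using hε0.le)).trans (le_of_eq ?_)
  rw [← Complex.ofReal_cpow hx.le, ← Complex.ofReal_cpow hx.le, ← Complex.ofReal_add,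
    ← Complex.ofReal_mul, Complex.norm_real, Real.norm_of_nonneg (by positivity)]

/-! ### Holomorphy of the Riesz integral and the gradient of `‖x‖ ^ s`. -/

/-- The integral `∫ ‖x‖ ^ s φ(x) dx`. -/
def rieszIntegral {n : ℕ} (s : ℂ) (φ : 𝓢(Eucl n, ℂ)) : ℂ :=
  ∫ x : Eucl n, ((‖x‖ : ℝ) : ℂ) ^ s * φ x

theorem hasDerivAt_rieszIntegral {n : ℕ} [NeZero n] {s₀ : ℂ} (hs : -(n : ℝ) < s₀.re)
    (φ : 𝓢(Eucl n, ℂ)) :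
    HasDerivAt (fun s => rieszIntegral s φ)
      (∫ x : Eucl n, (((Real.log ‖x‖ : ℝ) : ℂ) * ((‖x‖ : ℝ) : ℂ) ^ s₀) * φ x) s₀ := by
  set ε : ℝ := (s₀.re + n) / 3 with hε
  have hε0 : 0 < ε := by rw [hε]; linarith
  have h1 := (((isTemperedFun_cpow n (s := ((s₀.re - 2 * ε : ℝ) : ℂ))
    (by rw [Complex.ofReal_re, hε]; linarith)).add
    (isTemperedFun_cpow n (s := ((s₀.re + 2 * ε : ℝ) : ℂ))
    (by rw [Complex.ofReal_re, hε]; linarith))).const_mul ((2 / ε : ℝ) : ℂ)).integrable_mul φ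
  refine (hasDerivAt_integral_of_dominated_loc_of_deriv_le (Metric.ball_mem_nhds s₀ hε0)
    (Eventually.of_forall fun s => ?_) ((isTemperedFun_cpow n hs).integrable_mul φ)
    (F' := fun s x => (((Real.log ‖x‖ : ℝ) : ℂ) * ((‖x‖ : ℝ) : ℂ) ^ s) * φ x)
    ?_ ?_ h1.norm ?_).2
  · exact (measurable_norm_cpow s).aestronglyMeasurable.mul φ.continuous.aestronglyMeasurable
  · exact (measurable_log_mul_norm_cpow s₀).aestronglyMeasurable.mul
      φ.continuous.aestronglyMeasurable
  · filter_upwards [ae_norm_pos n] with x hx s hs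
    rw [norm_mul, norm_mul (_ * _) (φ x), norm_mul, norm_norm_cpow hx, Complex.norm_real,
      Real.norm_eq_abs]
    gcongr
    have hd : |s.re - s₀.re| ≤ ε := by
      rw [← Complex.sub_re]
      exact (Complex.abs_re_le_norm _).trans (by simpa [dist_eq_norm] using (Metric.mem_ball.1 hs).le)
    refine (abs_log_mul_rpow_le hx hε0 hd).trans (le_of_eq ?_)
    rw [← Complex.ofReal_cpow hx.le, ← Complex.ofReal_cpow hx.le, ← Complex.ofReal_add,
      ← Complex.ofReal_mul, Complex.norm_real, Real.norm_of_nonneg (by positivity)]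
  · filter_upwards [ae_norm_pos n] with x hx s _
    have h0 : ((‖x‖ : ℝ) : ℂ) ≠ 0 := by exact_mod_cast hx.ne'
    have := ((hasDerivAt_id s).const_cpow (c := ((‖x‖ : ℝ) : ℂ)) (Or.inl h0)).mul_const (φ x)
    convert! this using 1
    rw [Complex.ofReal_log hx.le, id]; ring

theorem ofReal_sq_cpow {r : ℝ} (hr : 0 < r) (w : ℂ) : ((r ^ 2 : ℝ) : ℂ) ^ w = (r : ℂ) ^ (2 * w) := by
  have h0 : (r : ℂ) ≠ 0 := by exact_mod_cast hr.ne'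
  rw [pow_two, Complex.ofReal_mul, Complex.mul_cpow_ofReal_nonneg hr.le hr.le, two_mul,
    Complex.cpow_add _ _ h0]

/-- Away from the origin this is the chain rule for `(‖x‖²)^(s/2)`. For `Re s > 1` the derivative at
the origin is `0`, in agreement with the formula, so integration by parts needs no excised ball. -/
theorem exists_hasFDerivAt_norm_cpow {n : ℕ} {s : ℂ} (hs : 1 < s.re) (x : Eucl n) :
    ∃ f' : Eucl n →L[ℝ] ℂ, HasFDerivAt (fun x : Eucl n => ((‖x‖ : ℝ) : ℂ) ^ s) f' x ∧
      ∀ v, f' v = s * ((‖x‖ : ℝ) : ℂ) ^ (s - 2) * ((inner ℝ x v : ℝ) : ℂ) := by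
  rcases eq_or_ne x 0 with rfl | hx
  · refine ⟨0, ?_, fun v => by simp⟩
    have h1 := hasFDerivAt_norm_rpow (0 : Eucl n) hs
    have h0 : s ≠ 0 := by rintro rfl; norm_num at hs
    have h0' : s.re ≠ 0 := by linarith
    rw [hasFDerivAt_iff_isLittleO_nhds_zero] at h1 ⊢
    -- The modulus of the complex power is the real power `‖y‖ ^ s.re`, so the little-o estimate is
    -- inherited from the real case.
    refine Asymptotics.IsLittleO.of_norm_left ((h1.norm_left).congr_left fun y => ?_)
    rcases eq_or_ne y 0 with rfl | hy
    · simp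
    · have hy' := norm_pos_iff.2 hy
      simp [h0, h0', norm_norm_cpow hy', abs_of_pos (Real.rpow_pos_of_pos hy' s.re)]
  · have hx' : 0 < ‖x‖ := norm_pos_iff.2 hx
    have h0 : s / 2 ≠ 0 := by
      intro h; have : s = 0 := by simpa using h
      rw [this] at hs; norm_num at hs
    have h1 := (hasDerivAt_ofReal_cpow_const (x := ‖x‖ ^ 2) (by positivity) h0).hasFDerivAt.comp x
      (hasStrictFDerivAt_norm_sq x).hasFDerivAt
    refine ⟨_, h1.congr_of_eventuallyEq ?_, fun v => ?_⟩
    · filter_upwards [isOpen_ne.mem_nhds hx] with y hy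
      simp only [Function.comp]
      rw [ofReal_sq_cpow (norm_pos_iff.2 hy)]
      congr 1; ring
    · rw [ofReal_sq_cpow hx']
      simp
      rw [show 2 * (s / 2 - 1) = s - 2 by ring]
      ring

/-! ### Coordinate multiplication and its commutators with derivatives. -/

/-- The `i`-th coordinate function. -/
def coord {n : ℕ} (i : Fin n) : Eucl n → ℂ := fun ξ => ((ξ i : ℝ) : ℂ)

theorem coord_hasTemperateGrowth {n : ℕ} (i : Fin n) : (coord i).HasTemperateGrowth :=
  (Complex.ofRealCLM.comp (EuclideanSpace.proj i : Eucl n →L[ℝ] ℝ)).hasTemperateGrowth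

/-- Multiplication of Schwartz functions by the `i`-th coordinate. -/
def coordMul {n : ℕ} (i : Fin n) : 𝓢(Eucl n, ℂ) →L[ℂ] 𝓢(Eucl n, ℂ) :=
  SchwartzMap.smulLeftCLM ℂ (coord i)

theorem coordMul_apply {n : ℕ} (i : Fin n) (φ : 𝓢(Eucl n, ℂ)) (x : Eucl n) :
    coordMul i φ x = ((x i : ℝ) : ℂ) * φ x := by
  rw [coordMul, SchwartzMap.smulLeftCLM_apply_apply (coord_hasTemperateGrowth i)]
  rfl

/-- The `i`-th standard basis vector. -/
abbrev stdVec {n : ℕ} (i : Fin n) : Eucl n := EuclideanSpace.single i (1 : ℝ)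

theorem lineDeriv_coordMul {n : ℕ} (i : Fin n) (v : Eucl n) (φ : 𝓢(Eucl n, ℂ)) :
    ∂_{v} (coordMul i φ) = ((v i : ℝ) : ℂ) • φ + coordMul i (∂_{v} φ) := by
  ext x
  rw [SchwartzMap.lineDerivOp_apply_eq_fderiv, _root_.add_apply, coordMul_apply,
    SchwartzMap.lineDerivOp_apply_eq_fderiv, _root_.smul_apply]
  have h1 : HasFDerivAt (fun y : Eucl n => ((y i : ℝ) : ℂ))
    (Complex.ofRealCLM.comp (EuclideanSpace.proj i : Eucl n →L[ℝ] ℝ)) x :=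
    (Complex.ofRealCLM.comp (EuclideanSpace.proj i : Eucl n →L[ℝ] ℝ)).hasFDerivAt
  have h2 := h1.mul (φ.hasFDerivAt x)
  have h3 : (coordMul i φ : Eucl n → ℂ) = fun y => ((y i : ℝ) : ℂ) * φ y :=
    funext (coordMul_apply i φ)
  rw [h3]
  change fderiv ℝ ((fun y : Eucl n => ((y i : ℝ) : ℂ)) * (φ : Eucl n → ℂ)) x v = _
  rw [h2.fderiv]
  simp [add_comm, mul_comm]

theorem lineDeriv_coordMul_self {n : ℕ} (i : Fin n) (φ : 𝓢(Eucl n, ℂ)) :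
    ∂_{stdVec i} (coordMul i φ) = φ + coordMul i (∂_{stdVec i} φ) := by
  rw [lineDeriv_coordMul]
  simp

theorem laplacian_eq_sum_stdVec {n : ℕ} (φ : 𝓢(Eucl n, ℂ)) :
    Δ φ = ∑ i : Fin n, ∂_{stdVec i} (∂_{stdVec i} φ) := by
  rw [SchwartzMap.laplacian_eq_sum (EuclideanSpace.basisFun (Fin n) ℝ)]
  simp

theorem laplacian_coordMul {n : ℕ} (i : Fin n) (φ : 𝓢(Eucl n, ℂ)) :
    Δ (coordMul i φ) = coordMul i (Δ φ) + (2 : ℂ) • ∂_{stdVec i} φ := by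
  have h : ∀ j : Fin n, ∂_{stdVec j} (∂_{stdVec j} (coordMul i φ)) =
      coordMul i (∂_{stdVec j} (∂_{stdVec j} φ)) +
        if i = j then (2 : ℂ) • ∂_{stdVec i} φ else 0 := by
    intro j
    rcases eq_or_ne i j with rfl | hij
    · rw [lineDeriv_coordMul_self, LineDeriv.lineDerivOp_add, lineDeriv_coordMul_self, if_pos rfl,
        two_smul]
      abel
    · have h0 : (((stdVec j : Eucl n) i : ℝ) : ℂ) = 0 := by simp [hij]
      simp only [lineDeriv_coordMul, h0, zero_smul, zero_add, if_neg hij, add_zero]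
  rw [laplacian_eq_sum_stdVec, laplacian_eq_sum_stdVec, Finset.sum_congr rfl fun j _ => h j,
    Finset.sum_add_distrib, map_sum]
  simp

/-! ### Functional equations by integration by parts, for `Re s > 2`. -/

/-- The tempered distribution `φ ↦ ∫ ‖x‖ ^ s φ(x) dx`, for `Re s > -n`. -/
def rieszDistr (n : ℕ) [NeZero n] {s : ℂ} (hs : -(n : ℝ) < s.re) : 𝓢'(Eucl n, ℂ) :=
  (isTemperedFun_cpow n hs).toDistr

theorem rieszDistr_apply {n : ℕ} [NeZero n] {s : ℂ} (hs : -(n : ℝ) < s.re)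
    (φ : 𝓢(Eucl n, ℂ)) : rieszDistr n hs φ = rieszIntegral s φ := rfl

theorem rieszIntegral_lineDeriv {n : ℕ} [NeZero n] {s : ℂ} (hs : 2 < s.re) (i : Fin n)
    (φ : 𝓢(Eucl n, ℂ)) :
    rieszIntegral s (∂_{stdVec i} φ) = -s * rieszIntegral (s - 2) (coordMul i φ) := by
  have hn : (0 : ℝ) ≤ n := Nat.cast_nonneg n
  have hs1 : -(n : ℝ) < s.re := by linarith
  have hs2 : -(n : ℝ) < (s - 2).re := by
    rw [Complex.sub_re]; norm_num; linarith
  choose f' hf' hf'v using fun x : Eucl n => exists_hasFDerivAt_norm_cpow (n := n)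
    (s := s) (by linarith) x
  have hd : ∀ x : Eucl n, fderiv ℝ (fun x : Eucl n => ((‖x‖ : ℝ) : ℂ) ^ s) x (stdVec i) * φ x =
      s * (((‖x‖ : ℝ) : ℂ) ^ (s - 2) * coordMul i φ x) := fun x => by
    rw [(hf' x).fderiv, hf'v, coordMul_apply, EuclideanSpace.inner_single_right]
    simp; ring
  have h := integral_mul_fderiv_eq_neg_fderiv_mul_of_integrable (μ := volume)
    (f := fun x : Eucl n => ((‖x‖ : ℝ) : ℂ) ^ s) (g := φ) (v := stdVec i)
    (by
      simp only [hd]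
      exact ((isTemperedFun_cpow n hs2).integrable_mul (coordMul i φ)).const_mul s)
    ((isTemperedFun_cpow n hs1).integrable_mul (∂_{stdVec i} φ))
    ((isTemperedFun_cpow n hs1).integrable_mul φ)
    (fun x _ => (hf' x).differentiableAt) (fun x _ => φ.differentiableAt)
  simp only [hd] at h
  rw [integral_const_mul, ← neg_mul] at h
  exact h

theorem rieszIntegral_sub_two {n : ℕ} [NeZero n] {s : ℂ} (φ : 𝓢(Eucl n, ℂ)) :
    rieszIntegral (s - 2) (∑ i, coordMul i (coordMul i φ)) = rieszIntegral s φ := by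
  refine integral_congr_ae ?_
  filter_upwards [ae_norm_pos n] with x hx
  have h0 : ((‖x‖ : ℝ) : ℂ) ≠ 0 := by exact_mod_cast hx.ne'
  rw [_root_.sum_apply]
  simp only [coordMul_apply, ← mul_assoc]
  rw [← Finset.sum_mul, ← mul_assoc]
  have h1 : (∑ i, ((x i : ℝ) : ℂ) * ((x i : ℝ) : ℂ)) = ((‖x‖ : ℝ) : ℂ) ^ 2 := by
    rw [← Complex.ofReal_pow, EuclideanSpace.real_norm_sq_eq]
    push_cast
    exact Finset.sum_congr rfl fun i _ => (pow_two _).symm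
  rw [h1, Complex.cpow_sub _ _ h0]
  norm_cast
  field_simp

/-- Integrate by parts twice, using `x_i ∂_i φ = ∂_i (x_i φ) - φ` in between. Summing over `i`, `∑
x_i² = ‖x‖²` contributes `s` and the commutators contribute `n`. -/
theorem rieszIntegral_laplacian {n : ℕ} [NeZero n] {s : ℂ} (hs : 2 < s.re)
    (φ : 𝓢(Eucl n, ℂ)) :
    rieszIntegral (s + 2) (Δ φ) = (s + 2) * (s + n) * rieszIntegral s φ := by
  have hn : (0 : ℝ) ≤ n := Nat.cast_nonneg n
  have hs1 : -(n : ℝ) < s.re := by linarith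
  have hs2 : -(n : ℝ) < (s - 2).re := by
    rw [Complex.sub_re]; norm_num; linarith
  have hs3 : -(n : ℝ) < (s + 2).re := by
    rw [Complex.add_re]; norm_num; linarith
  have h1 : ∀ i : Fin n, rieszIntegral (s + 2) (∂_{stdVec i} (∂_{stdVec i} φ)) =
      (s + 2) * (s * rieszIntegral (s - 2) (coordMul i (coordMul i φ)) + rieszIntegral s φ) := by
    intro i
    -- Passing through `rieszDistr` supplies linearity in the test function; `rieszIntegral` is a
    -- bare function.
    rw [rieszIntegral_lineDeriv (by rw [Complex.add_re]; norm_num; linarith),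
      show s + 2 - 2 = s by ring, eq_sub_of_add_eq' (lineDeriv_coordMul_self i φ).symm,
      ← rieszDistr_apply hs1, map_sub, rieszDistr_apply, rieszDistr_apply,
      rieszIntegral_lineDeriv hs]
    ring
  rw [laplacian_eq_sum_stdVec, ← rieszDistr_apply hs3, map_sum]
  simp only [rieszDistr_apply, h1]
  rw [← Finset.mul_sum, Finset.sum_add_distrib, ← Finset.mul_sum]
  simp only [← rieszDistr_apply hs2]
  rw [← map_sum, rieszDistr_apply, rieszIntegral_sub_two]
  simp
  ring

/-- The Gamma normalization absorbs the factor `s + n` of the Laplacian formula, leaving `s + 2` as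
the only factor to divide by in the continuation. -/
theorem inv_Gamma_shift {n : ℕ} {s : ℂ} (hs : (n : ℂ) / 2 + s / 2 ≠ 0) :
    (n + s) * (Complex.Gamma ((n : ℂ) / 2 + (s + 2) / 2))⁻¹ =
      2 * (Complex.Gamma ((n : ℂ) / 2 + s / 2))⁻¹ := by
  rw [show (n : ℂ) / 2 + (s + 2) / 2 = ((n : ℂ) / 2 + s / 2) + 1 by ring,
    Complex.Gamma_add_one _ hs, mul_inv, show (n : ℂ) + s = 2 * ((n : ℂ) / 2 + s / 2) by ring,
    mul_assoc, mul_inv_cancel_left₀ hs]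

/-- `h_s` tested against a Schwartz function, for `Re s > -n`. -/
def normPowIntegral {n : ℕ} (s : ℂ) (φ : 𝓢(Eucl n, ℂ)) : ℂ :=
  (Complex.Gamma ((n : ℂ) / 2 + s / 2))⁻¹ * rieszIntegral s φ

theorem integral_normPow {n : ℕ} (s : ℂ) (φ : 𝓢(Eucl n, ℂ)) :
    ∫ ξ : Eucl n, normPow n s ξ * φ ξ = normPowIntegral s φ := by
  simp only [normPow, normPowIntegral, rieszIntegral, mul_assoc]
  rw [integral_const_mul]

theorem half_add_half_ne_zero {n : ℕ} {s : ℂ} (hs : -(n : ℝ) < s.re) :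
    (n : ℂ) / 2 + s / 2 ≠ 0 := by
  intro h
  have h1 : (n : ℂ) + s = 0 := by linear_combination 2 * h
  have := congrArg Complex.re h1
  simp at this
  linarith

theorem normPowIntegral_laplacian {n : ℕ} [NeZero n] {s : ℂ} (hs : 2 < s.re)
    (φ : 𝓢(Eucl n, ℂ)) :
    normPowIntegral (s + 2) (Δ φ) = 2 * (s + 2) * normPowIntegral s φ := by
  have hn : (0 : ℝ) ≤ n := Nat.cast_nonneg n
  have h := inv_Gamma_shift (half_add_half_ne_zero (n := n) (s := s) (by linarith))
  simp only [normPowIntegral]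
  rw [rieszIntegral_laplacian hs]
  linear_combination (s + 2) * rieszIntegral s φ * h

theorem normPowIntegral_lineDeriv {n : ℕ} [NeZero n] {s : ℂ} (hs : 2 < s.re) (i : Fin n)
    (φ : 𝓢(Eucl n, ℂ)) :
    2 * (s + 2) * normPowIntegral s (coordMul i φ) =
      -(n + s) * normPowIntegral (s + 2) (∂_{stdVec i} φ) := by
  have hn : (0 : ℝ) ≤ n := Nat.cast_nonneg n
  have h := inv_Gamma_shift (half_add_half_ne_zero (n := n) (s := s) (by linarith))
  simp only [normPowIntegral]
  rw [rieszIntegral_lineDeriv (by rw [Complex.add_re]; norm_num; linarith),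
    show s + 2 - 2 = s by ring]
  linear_combination (-(s + 2)) * rieszIntegral s (coordMul i φ) * h

/-! ### Analytic continuation and existence of the entire extension. -/

theorem isOpen_rightHalfPlane (c : ℝ) : IsOpen {s : ℂ | c < s.re} :=
  isOpen_lt continuous_const Complex.continuous_re

/-- The identity theorem on a right half plane, for functions that agree far to the right. -/
theorem eq_of_eq_far_right {f g : ℂ → ℂ} {c : ℝ} (d : ℝ)
    (hf : DifferentiableOn ℂ f {s | c < s.re}) (hg : DifferentiableOn ℂ g {s | c < s.re})
    (h : ∀ s : ℂ, d < s.re → f s = g s) {s : ℂ} (hs : c < s.re) : f s = g s := by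
  have hpre : IsPreconnected {s : ℂ | c < s.re} := (convex_halfSpace_re_gt c).isPreconnected
  set z : ℂ := ((max c d + 1 : ℝ) : ℂ) with hz
  have hzc : c < z.re := by
    rw [hz, Complex.ofReal_re]; linarith [le_max_left c d]
  have hzd : d < z.re := by
    rw [hz, Complex.ofReal_re]; linarith [le_max_right c d]
  refine (hf.analyticOnNhd (isOpen_rightHalfPlane c)).eqOn_of_preconnected_of_eventuallyEq
    (hg.analyticOnNhd (isOpen_rightHalfPlane c)) hpre hzc ?_ hs
  filter_upwards [(isOpen_rightHalfPlane d).mem_nhds hzd] with w hw using h w hw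

theorem differentiable_inv_Gamma (n : ℕ) :
    Differentiable ℂ (fun s : ℂ => (Complex.Gamma ((n : ℂ) / 2 + s / 2))⁻¹) :=
  Complex.differentiable_one_div_Gamma.comp (by fun_prop)

theorem differentiableOn_normPowIntegral {n : ℕ} [NeZero n] (φ : 𝓢(Eucl n, ℂ)) :
    DifferentiableOn ℂ (fun s => normPowIntegral s φ) {s | -(n : ℝ) < s.re} := fun s hs =>
  ((differentiable_inv_Gamma n s).mul
    (hasDerivAt_rieszIntegral hs φ).differentiableAt).differentiableWithinAt

theorem integral_lineDeriv_eq_zero {n : ℕ} (v : Eucl n) (φ : 𝓢(Eucl n, ℂ)) :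
    ∫ x, (∂_{v} φ) x = 0 := by
  have h := integral_mul_fderiv_eq_neg_fderiv_mul_of_integrable (μ := volume)
    (f := fun _ : Eucl n => (1 : ℂ)) (g := φ) (v := v) (by simp)
    (by simpa using! (∂_{v} φ).integrable) (by simpa using φ.integrable)
    (fun x _ => by fun_prop) (fun x _ => φ.differentiableAt)
  simpa using! h

/-- `h_0` is a constant function, and derivatives of Schwartz functions integrate to zero. This
cancels the pole at `s = -2` in the continuation. -/
theorem normPowIntegral_zero_laplacian {n : ℕ} (φ : 𝓢(Eucl n, ℂ)) :
    normPowIntegral 0 (Δ φ) = 0 := by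
  have h : ∫ x, (Δ φ) x = 0 := by
    rw [laplacian_eq_sum_stdVec]
    simp only [_root_.sum_apply]
    rw [integral_finsetSum _ fun i _ => (∂_{stdVec i} (∂_{stdVec i} φ)).integrable]
    exact Finset.sum_eq_zero fun i _ => integral_lineDeriv_eq_zero _ _
  simp [normPowIntegral, rieszIntegral, h]

/-- `K` extends `s ↦ h_s` holomorphically to the half plane `Re s > -n - 2k`. -/
structure IsExtension (n k : ℕ) (K : ℂ → 𝓢'(Eucl n, ℂ)) : Prop where
  differentiableOn : ∀ φ : 𝓢(Eucl n, ℂ),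
    DifferentiableOn ℂ (fun s => K s φ) {s | -(n : ℝ) - 2 * k < s.re}
  eq_integral : ∀ s : ℂ, -(n : ℝ) < s.re → ∀ φ : 𝓢(Eucl n, ℂ), K s φ = normPowIntegral s φ

theorem IsExtension.apply_eq {n k l : ℕ} {K L : ℂ → 𝓢'(Eucl n, ℂ)} (hK : IsExtension n k K)
    (hL : IsExtension n l L) (φ : 𝓢(Eucl n, ℂ)) {s : ℂ} (hk : -(n : ℝ) - 2 * k < s.re)
    (hl : -(n : ℝ) - 2 * l < s.re) : K s φ = L s φ := by
  refine eq_of_eq_far_right (c := max (-(n : ℝ) - 2 * k) (-(n : ℝ) - 2 * l)) (-(n : ℝ))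
    ((hK.differentiableOn φ).mono fun s (hs : _ < s.re) => (le_max_left _ _).trans_lt hs)
    ((hL.differentiableOn φ).mono fun s (hs : _ < s.re) => (le_max_right _ _).trans_lt hs)
    (fun s hs => by rw [hK.eq_integral s hs, hL.eq_integral s hs]) (max_lt hk hl)

/-- The derivative of `s ↦ h_s` at `s = 0`. -/
def normPowDeriv (n : ℕ) [NeZero n] (h0 : -(n : ℝ) < (0 : ℂ).re) : 𝓢'(Eucl n, ℂ) :=
  deriv (fun s : ℂ => (Complex.Gamma ((n : ℂ) / 2 + s / 2))⁻¹) 0 • rieszDistr n h0 +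
    (Complex.Gamma ((n : ℂ) / 2 + 0 / 2))⁻¹ • (isTemperedFun_log_mul_cpow n h0).toDistr

theorem hasDerivAt_normPowIntegral_zero {n : ℕ} [NeZero n] (h0 : -(n : ℝ) < (0 : ℂ).re)
    (φ : 𝓢(Eucl n, ℂ)) :
    HasDerivAt (fun s => normPowIntegral s φ) (normPowDeriv n h0 φ) 0 :=
  (differentiable_inv_Gamma n 0).hasDerivAt.mul (hasDerivAt_rieszIntegral h0 φ)

/-- The transpose of the Laplacian. -/
def compLaplacian {n : ℕ} (T : 𝓢'(Eucl n, ℂ)) : 𝓢'(Eucl n, ℂ) :=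
  PointwiseConvergenceCLM.precomp ℂ (LineDeriv.laplacianCLM ℂ (Eucl n) 𝓢(Eucl n, ℂ)) T

theorem compLaplacian_apply {n : ℕ} (T : 𝓢'(Eucl n, ℂ)) (φ : 𝓢(Eucl n, ℂ)) :
    compLaplacian T φ = T (Δ φ) := by
  rw [← SchwartzMap.laplacianCLM_eq ℂ φ]
  rfl

open Classical in
theorem exists_isExtension_zero (n : ℕ) [NeZero n] : ∃ K, IsExtension n 0 K := by
  let K : ℂ → 𝓢'(Eucl n, ℂ) := fun s => if hs : -(n : ℝ) < s.re then
    (Complex.Gamma ((n : ℂ) / 2 + s / 2))⁻¹ • rieszDistr n hs else 0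
  have hK : ∀ s : ℂ, -(n : ℝ) < s.re → ∀ φ : 𝓢(Eucl n, ℂ), K s φ = normPowIntegral s φ :=
    fun s hs φ => by
      simp only [K, dif_pos hs]
      rfl
  refine ⟨K, fun φ => ?_, hK⟩
  simp only [Nat.cast_zero, mul_zero, sub_zero]
  exact (differentiableOn_normPowIntegral φ).congr fun s hs => hK s hs φ

/-- Define the new family by `K (s+2) ∘ Δ` divided by `2(s+2)`. Tested on `φ` it is half the
`dslope` at `-2` of a holomorphic function vanishing there, hence holomorphic. -/
theorem IsExtension.exists_succ {n k : ℕ} [NeZero n] {K : ℂ → 𝓢'(Eucl n, ℂ)}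
    (hK : IsExtension n k K) : ∃ L, IsExtension n (k + 1) L := by
  have hn : (0 : ℝ) < n := by exact_mod_cast NeZero.pos n
  have h0 : -(n : ℝ) < (0 : ℂ).re := by simpa using hn
  let L : ℂ → 𝓢'(Eucl n, ℂ) := fun s => (1 / 2 : ℂ) •
    -- The limit of the quotient at `-2` is the derivative of the family at `0` composed with `Δ`.
    -- An explicit distribution is used so that continuity in `φ` is automatic.
    if s = -2 then compLaplacian (normPowDeriv n h0) else (s + 2)⁻¹ • compLaplacian (K (s + 2))
  have hL : ∀ s φ, L s φ = (1 / 2 : ℂ) * dslope (fun s => K (s + 2) (Δ φ)) (-2) s := by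
    intro s φ
    rcases eq_or_ne s (-2) with rfl | hs
    · have h1 : HasDerivAt (fun s => K (s + 2) (Δ φ)) (normPowDeriv n h0 (Δ φ)) (-2) := by
        have h2 : HasDerivAt (fun s => K s (Δ φ)) (normPowDeriv n h0 (Δ φ)) (-2 + 2) := by
          rw [neg_add_cancel]
          refine (hasDerivAt_normPowIntegral_zero h0 (Δ φ)).congr_of_eventuallyEq ?_
          filter_upwards [(isOpen_rightHalfPlane (-(n : ℝ))).mem_nhds h0] with z hz
          exact hK.eq_integral z hz _
        exact h2.comp_add_const (-2) 2
      rw [dslope_same, h1.deriv, ← compLaplacian_apply]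
      simp only [L, if_true]
      rfl
    · have h1 : K (-2 + 2) (Δ φ) = 0 := by
        rw [neg_add_cancel, hK.eq_integral 0 h0, normPowIntegral_zero_laplacian]
      rw [dslope_of_ne _ hs, slope_def_field, h1, sub_zero, sub_neg_eq_add, div_eq_inv_mul _ (s + 2)]
      simp only [← compLaplacian_apply, L, if_neg hs]
      rfl
  have hdiff : ∀ φ : 𝓢(Eucl n, ℂ),
      DifferentiableOn ℂ (fun s => L s φ) {s | -(n : ℝ) - 2 * (k + 1 : ℕ) < s.re} := by
    intro φ
    simp only [hL]
    refine DifferentiableOn.const_mul ?_ _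
    rw [Complex.differentiableOn_dslope]
    · refine (hK.differentiableOn (Δ φ)).comp (by fun_prop) fun s hs => ?_
      simp only [Set.mem_ofPred_eq] at hs ⊢
      rw [Complex.add_re]
      push_cast at hs
      norm_num
      linarith
    · refine (isOpen_rightHalfPlane _).mem_nhds ?_
      have : (0 : ℝ) ≤ k := Nat.cast_nonneg k
      simp only [Set.mem_ofPred_eq]
      push_cast
      norm_num
      linarith
  refine ⟨L, hdiff, fun s hs φ => ?_⟩
  -- Agreement with the integral is checked only for `Re s > 2`, where the Laplacian formula
  -- applies; the identity theorem carries it to `Re s > -n`.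
  refine eq_of_eq_far_right 2 ((hdiff φ).mono fun s hs => ?_)
    (differentiableOn_normPowIntegral φ) (fun s hs => ?_) hs
  · have : (0 : ℝ) ≤ ((k + 1 : ℕ) : ℝ) := Nat.cast_nonneg _
    simp only [Set.mem_ofPred_eq] at hs ⊢
    linarith
  · have hs2 : s + 2 ≠ 0 := by
      intro h
      have := congrArg Complex.re h
      rw [Complex.add_re] at this
      norm_num at this
      linarith
    have hs3 : s ≠ -2 := fun h => hs2 (by rw [h]; ring)
    have h1 : L s φ = (1 / 2 : ℂ) * ((s + 2)⁻¹ * K (s + 2) (Δ φ)) := by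
      rw [← compLaplacian_apply]
      simp only [L, if_neg hs3]
      rfl
    simp only [h1]
    rw [hK.eq_integral _ (by rw [Complex.add_re]; norm_num; linarith),
      normPowIntegral_laplacian hs]
    field_simp

theorem exists_isExtension (n : ℕ) [NeZero n] (k : ℕ) : ∃ K, IsExtension n k K := by
  induction k with
  | zero => exact exists_isExtension_zero n
  | succ k ih =>
    obtain ⟨K, hK⟩ := ih
    exact hK.exists_succ

/-- Glue the partial extensions, taking at `s` the one of index `⌈‖s‖⌉₊ + 1`, whose half plane
contains `s`. Overlapping extensions agree, so near `s` the glued family coincides with a single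
one. -/
theorem exists_isEntireExtension (n : ℕ) [NeZero n] : ∃ K, IsEntireExtension n K := by
  choose K hK using exists_isExtension n
  have hn : (0 : ℝ) ≤ n := Nat.cast_nonneg n
  have hc : ∀ s : ℂ, -(n : ℝ) - 2 * (⌈‖s‖⌉₊ + 1 : ℕ) < s.re := fun s => by
    have h1 := Nat.le_ceil ‖s‖
    have h2 := (abs_le.1 (Complex.abs_re_le_norm s)).1
    push_cast
    linarith [norm_nonneg s]
  refine ⟨fun s => K (⌈‖s‖⌉₊ + 1) s, fun φ s => ?_, fun s hs φ => ?_⟩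
  · have hmem := (isOpen_rightHalfPlane _).mem_nhds (hc s)
    refine (((hK (⌈‖s‖⌉₊ + 1)).differentiableOn φ).differentiableAt hmem).congr_of_eventuallyEq ?_
    filter_upwards [hmem] with z hz
    exact (hK _).apply_eq (hK _) φ (hc z) hz
  · rw [integral_normPow]
    exact (hK _).eq_integral s hs φ

theorem isEntireExtension_h (n : ℕ) [NeZero n] : IsEntireExtension n (h n) := by
  have hex := exists_isEntireExtension n
  have : h n = hex.choose := by
    funext s
    simp only [h, dif_pos hex]
  rw [this]
  exact hex.choose_spec

/-! ### The two identities for all complex `s`. -/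

theorem eq_of_entire_of_eq_far_right {f g : ℂ → ℂ} (d : ℝ) (hf : Differentiable ℂ f)
    (hg : Differentiable ℂ g) (h : ∀ s : ℂ, d < s.re → f s = g s) (s : ℂ) : f s = g s :=
  eq_of_eq_far_right (c := s.re - 1) d hf.differentiableOn hg.differentiableOn h (by linarith)

theorem h_apply_eq {n : ℕ} [NeZero n] {s : ℂ} (hs : -(n : ℝ) < s.re) (φ : 𝓢(Eucl n, ℂ)) :
    h n s φ = normPowIntegral s φ := by
  rw [(isEntireExtension_h n).eq_integral s hs, integral_normPow]

theorem differentiable_h_add_two {n : ℕ} [NeZero n] (φ : 𝓢(Eucl n, ℂ)) :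
    Differentiable ℂ (fun s => h n (s + 2) φ) :=
  ((isEntireExtension_h n).entire φ).comp (by fun_prop)

/-- `Δ h_{s+2} = 2 (s + 2) h_s`. -/
theorem h_laplacian {n : ℕ} [NeZero n] (s : ℂ) (φ : 𝓢(Eucl n, ℂ)) :
    h n (s + 2) (Δ φ) = 2 * (s + 2) * h n s φ := by
  have hn : (0 : ℝ) ≤ n := Nat.cast_nonneg n
  refine eq_of_entire_of_eq_far_right (f := fun s => h n (s + 2) (Δ φ))
    (g := fun s => 2 * (s + 2) * h n s φ) 2
    (differentiable_h_add_two _) (((differentiable_id.add_const 2).const_mul 2).mul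
      ((isEntireExtension_h n).entire φ)) (fun s hs => ?_) s
  rw [h_apply_eq (by rw [Complex.add_re]; norm_num; linarith), h_apply_eq (by linarith),
    normPowIntegral_laplacian hs]

/-- `2 (s + 2) ξ_i h_s = (n + s) ∂_i h_{s+2}`. -/
theorem h_coordMul {n : ℕ} [NeZero n] (s : ℂ) (i : Fin n) (φ : 𝓢(Eucl n, ℂ)) :
    2 * (s + 2) * h n s (coordMul i φ) = -(n + s) * h n (s + 2) (∂_{stdVec i} φ) := by
  have hn : (0 : ℝ) ≤ n := Nat.cast_nonneg n
  refine eq_of_entire_of_eq_far_right (f := fun s => 2 * (s + 2) * h n s (coordMul i φ))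
    (g := fun s => -(n + s) * h n (s + 2) (∂_{stdVec i} φ)) 2
    (((differentiable_id.add_const 2).const_mul 2).mul ((isEntireExtension_h n).entire _))
    ((differentiable_id.const_add (n : ℂ)).neg.mul (differentiable_h_add_two _)) (fun s hs => ?_) s
  rw [h_apply_eq (by linarith), h_apply_eq (by rw [Complex.add_re]; norm_num; linarith),
    normPowIntegral_lineDeriv hs]

/-! ### Convolution and reflection against derivatives and coordinates. -/

/-- Convolution of Schwartz functions. -/
abbrev sconv {n : ℕ} (a : 𝓢(Eucl n, ℂ)) : 𝓢(Eucl n, ℂ) →L[ℂ] 𝓢(Eucl n, ℂ) :=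
  SchwartzMap.convolution (ContinuousLinearMap.mul ℂ ℂ) a

/-- The Fourier transform turns convolution into a product and the derivative into a scalar
multiplier, which may be attached to either factor. -/
theorem lineDeriv_sconv {n : ℕ} (v : Eucl n) (a b : 𝓢(Eucl n, ℂ)) :
    ∂_{v} (sconv a b) = sconv (∂_{v} a) b := by
  refine (FourierTransform.fourierEquiv ℂ 𝓢(Eucl n, ℂ)).injective ?_
  change 𝓕 (∂_{v} (sconv a b)) = 𝓕 (sconv (∂_{v} a) b)
  have hv : (inner ℝ · v : Eucl n → ℝ).HasTemperateGrowth := by fun_prop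
  rw [SchwartzMap.fourier_lineDerivOp_eq, SchwartzMap.fourier_convolution,
    SchwartzMap.fourier_convolution, SchwartzMap.fourier_lineDerivOp_eq]
  ext x
  simp only [_root_.smul_apply, SchwartzMap.smulLeftCLM_apply_apply hv,
    SchwartzMap.pairing_apply_apply, ContinuousLinearMap.mul_apply', smul_eq_mul,
    Complex.real_smul]
  ring

theorem laplacian_sconv {n : ℕ} (a b : 𝓢(Eucl n, ℂ)) :
    Δ (sconv a b) = sconv (Δ a) b := by
  simp only [laplacian_eq_sum_stdVec, lineDeriv_sconv, sconv, map_sum,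
    _root_.sum_apply]

theorem integrable_mul_comp_sub {n : ℕ} (a b : 𝓢(Eucl n, ℂ)) (x : Eucl n) :
    Integrable (fun t => a t * b (x - t)) :=
  a.integrable.mul_bdd (c := SchwartzMap.seminorm ℝ 0 0 b)
    (b.continuous.comp (by fun_prop)).aestronglyMeasurable
    (ae_of_all _ fun t => SchwartzMap.norm_le_seminorm ℝ b _)

theorem sconv_apply {n : ℕ} (a b : 𝓢(Eucl n, ℂ)) (x : Eucl n) :
    sconv a b x = ∫ t, a t * b (x - t) := by
  rw [sconv, SchwartzMap.convolution_apply]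
  rfl

/-- Under the integral sign, split `x_i = t_i + (x_i - t_i)`. -/
theorem coordMul_sconv {n : ℕ} (i : Fin n) (a b : 𝓢(Eucl n, ℂ)) :
    coordMul i (sconv a b) = sconv (coordMul i a) b + sconv a (coordMul i b) := by
  ext x
  rw [_root_.add_apply, coordMul_apply, sconv_apply, sconv_apply, sconv_apply,
    ← integral_add (integrable_mul_comp_sub _ _ x) (integrable_mul_comp_sub _ _ x),
    ← integral_const_mul]
  refine integral_congr_ae (ae_of_all _ fun t => ?_)
  simp only [coordMul_apply, PiLp.sub_apply, Complex.ofReal_sub]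
  ring

theorem reflect_apply {n : ℕ} (f : 𝓢(Eucl n, ℂ)) (x : Eucl n) : reflect n f x = f (-x) := rfl

theorem reflect_coordMul {n : ℕ} (i : Fin n) (f : 𝓢(Eucl n, ℂ)) :
    reflect n (coordMul i f) = -coordMul i (reflect n f) := by
  ext x
  rw [_root_.neg_apply, reflect_apply, coordMul_apply, coordMul_apply, reflect_apply]
  simp

theorem reflect_lineDeriv {n : ℕ} (v : Eucl n) (f : 𝓢(Eucl n, ℂ)) :
    reflect n (∂_{v} f) = -∂_{v} (reflect n f) := by
  rw [reflect, SchwartzMap.lineDerivOp_compCLMOfContinuousLinearEquiv,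
    ContinuousLinearEquiv.neg_apply, LineDeriv.lineDerivOp_left_neg, map_neg, neg_neg]

theorem reflect_laplacian {n : ℕ} (f : 𝓢(Eucl n, ℂ)) :
    reflect n (Δ f) = Δ (reflect n f) := by
  simp only [laplacian_eq_sum_stdVec, map_sum, reflect_lineDeriv, LineDeriv.lineDerivOp_neg,
    neg_neg]

/-! ### The intertwining identity. -/

theorem E_apply {n : ℕ} [NeZero n] (lam : ℂ) (f : 𝓢(Eucl n, ℂ)) :
    E n lam f = (2 * lam - n + 2) • ∂_{stdVec (lastIdx n)} f + coordMul (lastIdx n) (Δ f) := by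
  rw [← SchwartzMap.laplacianCLM_eq ℂ f]
  rfl

/-- Moving `ξ_n` inside the Laplacian costs `2 ∂_n`, which lowers the coefficient `2λ - n + 2` to
`2λ - n`. This is exactly `n + s` at `s = -2n + 2λ`, the coefficient in `h_coordMul`. -/
theorem reflect_E {n : ℕ} [NeZero n] (lam : ℂ) (f : 𝓢(Eucl n, ℂ)) :
    reflect n (E n lam f) = -((2 * lam - n) • ∂_{stdVec (lastIdx n)} (reflect n f) +
      Δ (coordMul (lastIdx n) (reflect n f))) := by
  rw [E_apply, map_add, map_smul, reflect_lineDeriv, reflect_coordMul, reflect_laplacian,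
    laplacian_coordMul]
  module

theorem sconv_reflect_E {n : ℕ} [NeZero n] (lam : ℂ) (f φ : 𝓢(Eucl n, ℂ)) :
    sconv (reflect n (E n lam f)) φ =
      -((2 * lam - n) • ∂_{stdVec (lastIdx n)} (sconv (reflect n f) φ) +
        Δ (sconv (coordMul (lastIdx n) (reflect n f)) φ)) := by
  rw [reflect_E, lineDeriv_sconv, laplacian_sconv]
  simp only [sconv, map_neg, map_add, map_smul, _root_.neg_apply, _root_.add_apply,
    _root_.smul_apply]

theorem J_apply {n : ℕ} (lam : ℂ) (f φ : 𝓢(Eucl n, ℂ)) :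
    J n lam f φ = h n (-2 * n + 2 * lam) (sconv (reflect n f) φ) := rfl

theorem M_apply {n : ℕ} [NeZero n] (T : 𝓢'(Eucl n, ℂ)) (φ : 𝓢(Eucl n, ℂ)) :
    M n T φ = T (coordMul (lastIdx n) φ) := rfl

/-- The Bernstein–Sato type identity, without division: it holds for every `λ`. -/
theorem J_E_apply {n : ℕ} [NeZero n] (lam : ℂ) (f φ : 𝓢(Eucl n, ℂ)) :
    J n (lam + 1) (E n lam f) φ = 4 * (lam - n + 1) * M n (J n lam f) φ := by
  have h1 := h_coordMul (-2 * n + 2 * lam) (lastIdx n) (sconv (reflect n f) φ)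
  have h2 := h_laplacian (-2 * n + 2 * lam) (sconv (coordMul (lastIdx n) (reflect n f)) φ)
  rw [coordMul_sconv, map_add] at h1
  rw [M_apply, J_apply, J_apply, sconv_reflect_E, map_neg, map_add, map_smul, smul_eq_mul,
    show (-2 * n + 2 * (lam + 1) : ℂ) = -2 * n + 2 * lam + 2 by ring, h2]
  -- After `h2` has replaced the Laplacian term, what remains is `h1` with `2(s+2) = 4(λ-n+1)` and
  -- `n+s = 2λ-n`.
  linear_combination -h1

theorem one_div_smul_J_E {n : ℕ} [NeZero n] {lam : ℂ} (hl : lam ≠ n - 1) (f : 𝓢(Eucl n, ℂ)) :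
    (1 / (4 * (lam - n + 1))) • J n (lam + 1) (E n lam f) = M n (J n lam f) := by
  have h0 : lam - n + 1 ≠ 0 := fun h => hl (by linear_combination h)
  ext φ
  change (1 / (4 * (lam - n + 1))) * J n (lam + 1) (E n lam f) φ = _
  rw [J_E_apply]
  field_simp

theorem continuous_M_J {n : ℕ} [NeZero n] (f : 𝓢(Eucl n, ℂ)) :
    Continuous (fun lam : ℂ => M n (J n lam f)) :=
  PointwiseConvergenceCLM.continuous_of_continuous_eval fun φ => by
    simp only [M_apply, J_apply]
    exact ((isEntireExtension_h n).entire _).continuous.comp (by fun_prop)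

end KnappStein

end

theorem proposition4p5 (n : ℕ) [NeZero n] :
    -- the family `h` is the entire extension of `|ξ|^s / Γ(n/2 + s/2)`
    KnappStein.IsEntireExtension n (KnappStein.h n) ∧
    -- the identity of operators from `𝓢(ℝⁿ)` to `𝓢'(ℝⁿ)`
    (∀ lam : ℂ, lam ≠ n - 1 →
      KnappStein.M n ∘L KnappStein.J n lam =
        (1 / (4 * (lam - n + 1))) • (KnappStein.J n (lam + 1) ∘L KnappStein.E n lam)) ∧
    -- its meaning at `λ = n - 1`
    KnappStein.J n n ∘L KnappStein.E n (n - 1) = 0 ∧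
    (∀ f : 𝓢(KnappStein.Eucl n, ℂ),
      Tendsto (fun lam : ℂ => (1 / (4 * (lam - n + 1))) •
          KnappStein.J n (lam + 1) (KnappStein.E n lam f))
        (𝓝[≠] ((n : ℂ) - 1)) (𝓝 (KnappStein.M n (KnappStein.J n (n - 1) f)))) := by
  refine ⟨KnappStein.isEntireExtension_h n, fun lam hl => ?_, ?_, fun f => ?_⟩
  · refine ContinuousLinearMap.ext fun f => ?_
    exact (KnappStein.one_div_smul_J_E hl f).symm
  · refine ContinuousLinearMap.ext fun f => ?_
    ext φ
    have h1 := KnappStein.J_E_apply ((n : ℂ) - 1) f φ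
    rw [sub_add_cancel, show (n : ℂ) - 1 - n + 1 = 0 by ring, mul_zero, zero_mul] at h1
    exact h1
  -- Off `n - 1` the quotient equals `M (J_λ f)`, which is continuous in `λ`, so the limit is its
  -- value at `n - 1`.
  · refine (((KnappStein.continuous_M_J f).tendsto ((n : ℂ) - 1)).mono_left
      nhdsWithin_le_nhds).congr' ?_
    filter_upwards [self_mem_nhdsWithin] with lam hl
    exact (KnappStein.one_div_smul_J_E hl f).symm
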